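/- Let $\mathcal U\subset\mathbb R^{d_o}$ be compact and convex, let $\mathcal X\subset\mathbb R^{d_r}$ be open and bounded, and let $\mu$ be a Borel probability measure on $\mathbb R^{d_r}$ with $\operatorname{supp}(\mu)\subset\mathcal X$; here $\mathbb R^{d_o}$ carries a norm induced by an inner product and $\mathbb R^{d_r}$ an arbitrary norm. Let $j\in C^1(\mathcal U\times\mathcal X;\mathbb R)$ and $J(u)=\int_{\mathcal X}j(u,x)\,\mu(\mathrm dx)$. Gradients of functions on $\mathcal U$ are understood relative to $\mathcal U$; if $\mathcal U$ has empty interior, $\nabla_1 j$ (assumed continuous on $\mathcal U\times\mathcal X$) and $\nabla J$ may be any choice of such gradients. Assume that $J$ is $L$-smooth with $L>0$, i.e. $\|\nabla J(u)-\nabla J(v)\|\le L\|u-v\|$ for all $u,v\in\mathcal U$. Write $P_{\mathcal U}$ for the orthogonal projection onto $\mathcal U$, and call $u^\ast\in\mathcal U$ a stationary point of $J$ if $P_{\mathcal U}(u^\ast-t\nabla J(u^\ast))=u^\ast$ for some $t>0$. Let $x_1,x_2,\ldots$ be independent, $\mathcal X$-valued random variables with law $\mu$ (such a sequence is almost surely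 dense in $\operatorname{supp}(\mu)$). Let $u_1\in\mathcal U$ be deterministic. The continuous stochastic gradient method (CSG) with constant step size $\tau$ produces $$u_{n+1}=P_{\mathcal U}\bigl(u_n-\tau\hat G_n\bigr),\qquad \hat G_n=\sum_{k=1}^n\alpha^{(n)}_k\,\nabla_1 j(u_k,x_k),$$ where the weights are $\alpha^{(n)}_k=\nu_n(\{y:\kappa_n(y)=k\})$. Here $\kappa_n$ is a measurable map such that $\kappa_n(y)\in\{1,\dots,n\}$ minimizes $k\mapsto\|u_n-u_k\|+\|y-x_k\|$ over $\{1,\dots,n\}$ for every $y$ (ties are broken arbitrarily), and $\nu_n$ is $\mu$ for all $n$ (exact weights), or the empirical measure $\frac1n\sum_{i=1}^n\delta_{x_i}$ for all $n$ (empirical weights), or, more generally, $(\nu_n)$ is a sequence of possibly random probability measures converging weakly to $\mu$ almost surely. The weights used in step $n$ are non-anticipating: for some filtration $(\mathcal F_n)$ such that $x_n$ is $\mathcal F_n$-measurable and $x_{n+1}$ is independent of $\mathcal F_n$ for all $n$, all $\alpha^{(n)}_k$ are $\mathcal F_n$-measurable. If $J$ has only finitely many stationary points on $\mathcal U$ and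 $0<\tau<\tfrac2L$, then almost surely the sequence $(u_n)$ converges to a stationary point of $J$. -/

import Mathlib

open MeasureTheory ProbabilityTheory Filter Topology
open scoped BoundedContinuousFunction

namespace CSG

section Optimization

variable {E : Type*} [NormedAddCommGroup E] [InnerProductSpace ℝ E]

/-- `g` is a gradient of `f` on `U`: at every `u ∈ U`, the derivative of `f` relative to `U` is
`v ↦ ⟪g u, v⟫`. If `U` is convex with nonempty interior, this determines `g` on `U`; in general it
determines `g` on `U` up to vectors orthogonal to the affine hull of `U`. -/
def IsGradientOn (f : E → ℝ) (g : E → E) (U : Set E) : Prop :=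
  ∀ u ∈ U, HasFDerivWithinAt f (innerSL ℝ (g u)) U u

/-- `p` is the orthogonal projection of `y` onto `U`, i.e. a minimizer of `v ↦ ‖y - v‖` over `U`
(it is unique if `U` is convex). -/
def IsProj (U : Set E) (y p : E) : Prop :=
  p ∈ U ∧ ∀ v ∈ U, ‖y - p‖ ≤ ‖y - v‖

/-- The set of stationary points on `U` of an objective with gradient `G`: those `u ∈ U` with
`P_U (u - t G(u)) = u` for some `t > 0`. -/
def stationaryPoints (U : Set E) (G : E → E) : Set E :=
  {u | u ∈ U ∧ ∃ t : ℝ, 0 < t ∧ IsProj U (u - t • G u) u}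

end Optimization

/-- The objective `J(u) = ∫_X j(u, x) μ(dx)`. -/
noncomputable def objective {E F : Type*} [MeasurableSpace F] (j : E → F → ℝ) (X : Set F)
    (μ : Measure F) (u : E) : ℝ :=
  ∫ x in X, j u x ∂μ

section Algorithm

variable {E : Type*} [NormedAddCommGroup E] [InnerProductSpace ℝ E]
variable {F : Type*} [NormedAddCommGroup F]

/-- `k` is the index of a nearest neighbour of `(u_n, y)` among `(u_0, x_0), …, (u_n, x_n)`, for
the distance `‖u_n - u_k‖ + ‖y - x_k‖`. -/
def IsNearestIndex (u : ℕ → E) (x : ℕ → F) (n : ℕ) (y : F) (k : ℕ) : Prop :=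
  k ≤ n ∧ ∀ i ≤ n, ‖u n - u k‖ + ‖y - x k‖ ≤ ‖u n - u i‖ + ‖y - x i‖

/-- The measures `ν n` on the parameter space with respect to which the nearest neighbour cells
are weighted in step `n`: either `μ` itself (exact weights), or the empirical measure of the
samples drawn so far (empirical weights), or any probability measures that converge weakly
to `μ`. -/
def IsReferenceMeasure [MeasurableSpace F] (μ : Measure F) (x : ℕ → F) (ν : ℕ → Measure F) :
    Prop :=
  (∀ n, ν n = μ) ∨
  (∀ n, ν n = ((n : ENNReal) + 1)⁻¹ • ∑ i ∈ Finset.range (n + 1), Measure.dirac (x i)) ∨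
  ((∀ n, IsProbabilityMeasure (ν n)) ∧
    ∀ f : F →ᵇ ℝ, Tendsto (fun n => ∫ y, f y ∂(ν n)) atTop (𝓝 (∫ y, f y ∂μ)))

/-- `α n 0, …, α n n` are weights of the CSG method in step `n`: the weight of the `k`-th gradient
sample is the mass, under the reference measure `ν n`, of the set of parameters `y` whose nearest
neighbour is the `k`-th one. Ties are broken by an arbitrary measurable choice `κ`. -/
def IsCSGWeights [MeasurableSpace F] (μ : Measure F) (x : ℕ → F) (u : ℕ → E)
    (α : ℕ → ℕ → ℝ) : Prop :=
  ∃ ν : ℕ → Measure F, IsReferenceMeasure μ x ν ∧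
    ∀ n, ∃ κ : F → ℕ, Measurable κ ∧ (∀ y, IsNearestIndex u x n y (κ y)) ∧
      ∀ k ≤ n, α n k = (ν n).real (κ ⁻¹' {k})

/-- The search direction `Ĝ_n = ∑_{k ≤ n} α_k ∇₁j(u_k, x_k)`, where `g` is `∇₁j`. -/
noncomputable def searchDirection (g : E → F → E) (x : ℕ → F) (u : ℕ → E) (α : ℕ → ℕ → ℝ)
    (n : ℕ) : E :=
  ∑ k ∈ Finset.range (n + 1), α n k • g (u k) (x k)

/-- `u` is the sequence of iterates of the CSG method started in `u₀`, for the samples `x`, the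
weights `α` and the step sizes `τ`: `u_{n+1} = P_U (u_n - τ_n Ĝ_n)`. Indices start at `0`. -/
def IsCSGSequence (U : Set E) (g : E → F → E) (u₀ : E) (τ : ℕ → ℝ) (x : ℕ → F)
    (α : ℕ → ℕ → ℝ) (u : ℕ → E) : Prop :=
  u 0 = u₀ ∧ ∀ n, IsProj U (u n - τ n • searchDirection g x u α n) (u (n + 1))

end Algorithm

end CSG

/-!
The iterates are projected gradient steps with a gradient error, and the theorem follows from two
facts: the error tends to zero almost surely, and for finitely many stationary points that is
enough for convergence, without any summability of the errors.

*The error vanishes.* By `CSG.IsCSGSequence.measurable` the iterate `u (n + 1)` is known before the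
sample `x (n + 1)` is drawn. Hence Lévy's extension of the Borel–Cantelli lemma applies: if the
iterates visit a ball infinitely often, then during these visits the samples hit every set of
positive measure (`CSG.ae_frequently_mem_and_mem`). Covering `U` and the support of `μ` by finitely
many small balls, the pairs `(u n, y)` with `y` in the support have arbitrarily near neighbours
among the sampled pairs, uniformly in `y`, once `n` is large
(`CSG.ae_eventually_forall_exists_near`). As the partial gradient extends from the compact set
`U × supp μ` to a uniformly continuous function, the nearest neighbour estimator is then close to
its integral against the reference measure, and this in turn is close to the integral against `μ`
by weak convergence. For empirical weights, the strong law of large numbers gives the convergence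
for countably many test functions, which are all that is needed
(`CSG.ae_tendsto_searchDirection_sub_integral`).

The limit `∫ g (u n, y) μ(dy)` is a gradient of the objective (`CSG.isGradientOn_objective`). It
may differ from the given gradient `G` if `U` has empty interior, but only by vectors orthogonal
to `U`, which the projection does not see (`CSG.IsGradientOn.inner_sub_eq`).

*Vanishing errors suffice.* With `d = u (n + 1) - u n`, the descent lemma and the variational
inequality of the projection give `J (u (n + 1)) ≤ J (u n) - c ‖d‖² + ‖e n‖ ‖d‖` for
`c = 1 / τ - L / 2 > 0`. An ascending step therefore has length at most `‖e n‖ / c`, so that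
infinitely many ascending steps between two levels would force a stationary point between these
levels. There are only finitely many stationary values, so any oscillation of `J (u n)` would have
to cross a band of levels without such values, which is impossible: `J (u n)` converges. Then the
step lengths tend to zero, all cluster points are stationary, and a sequence with vanishing
increments and finitely many cluster points in a compact set converges
(`CSG.exists_tendsto_of_error_tendsto_zero`).
-/

namespace CSG

/-! ### Projections, stationary points and the descent lemma -/

section Optimization

variable {E : Type*} [NormedAddCommGroup E] [InnerProductSpace ℝ E] {U : Set E}

theorem isProj_iff_inner_le_zero (hU : Convex ℝ U) {y p : E} :
    IsProj U y p ↔ p ∈ U ∧ ∀ v ∈ U, inner ℝ (y - p) (v - p) ≤ 0 := by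
  constructor
  · rintro ⟨hp, h⟩
    refine ⟨hp, (norm_eq_iInf_iff_real_inner_le_zero hU hp).1 ?_⟩
    have : Nonempty U := ⟨⟨p, hp⟩⟩
    refine le_antisymm (le_ciInf fun w => h w w.2) ?_
    exact ciInf_le (f := fun w : U => ‖y - w‖)
      ⟨0, by rintro _ ⟨w, rfl⟩; exact norm_nonneg _⟩ ⟨p, hp⟩
  · rintro ⟨hp, h⟩
    refine ⟨hp, fun v hv => ?_⟩
    rw [(norm_eq_iInf_iff_real_inner_le_zero hU hp).2 h]
    exact ciInf_le (f := fun w : U => ‖y - w‖)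
      ⟨0, by rintro _ ⟨w, rfl⟩; exact norm_nonneg _⟩ ⟨v, hv⟩

/-- Stationarity is a variational inequality; in particular it does not depend on the step size
`t` in the definition. -/
theorem mem_stationaryPoints_iff (hU : Convex ℝ U) {G : E → E} {p : E} :
    p ∈ stationaryPoints U G ↔ p ∈ U ∧ ∀ v ∈ U, 0 ≤ inner ℝ (G p) (v - p) := by
  have key : ∀ t v, inner ℝ (p - t • G p - p) (v - p) = -(t * inner ℝ (G p) (v - p)) := by
    intro t v
    rw [sub_sub_cancel_left, inner_neg_left, real_inner_smul_left]
  constructor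
  · rintro ⟨hp, t, ht, h⟩
    refine ⟨hp, fun v hv => ?_⟩
    have := ((isProj_iff_inner_le_zero hU).1 h).2 v hv
    rw [key] at this
    exact nonneg_of_mul_nonneg_right (by linarith) ht
  · rintro ⟨hp, h⟩
    refine ⟨hp, 1, one_pos, (isProj_iff_inner_le_zero hU).2 ⟨hp, fun v hv => ?_⟩⟩
    rw [key]
    linarith [h v hv]

/-- The projection onto a convex set is nonexpansive. -/
theorem IsProj.norm_sub_le (hU : Convex ℝ U) {y z p q : E} (hp : IsProj U y p)
    (hq : IsProj U z q) : ‖p - q‖ ≤ ‖y - z‖ := by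
  rw [isProj_iff_inner_le_zero hU] at hp hq
  have h1 := hp.2 q hq.1
  have h2 := hq.2 p hp.1
  have h3 : inner ℝ (y - p) (q - p) + inner ℝ (z - q) (p - q)
      = ‖p - q‖ ^ 2 - inner ℝ (y - z) (p - q) := by
    rw [← real_inner_self_eq_norm_sq]
    simp only [inner_sub_left, inner_sub_right]
    ring
  have h4 := real_inner_le_norm (y - z) (p - q)
  by_contra! hlt
  nlinarith [norm_nonneg (y - z), norm_nonneg (p - q)]

/-- The descent lemma: a function whose gradient is `L`-Lipschitz on a convex set lies below its
quadratic upper model. -/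
theorem IsGradientOn.le_quadratic (hU : Convex ℝ U) {J : E → ℝ} {G : E → E}
    (hG : IsGradientOn J G U) {L : ℝ}
    (hsmooth : ∀ u ∈ U, ∀ v ∈ U, ‖G u - G v‖ ≤ L * ‖u - v‖) {u v : E} (hu : u ∈ U) (hv : v ∈ U) :
    J v ≤ J u + inner ℝ (G u) (v - u) + L / 2 * ‖v - u‖ ^ 2 := by
  set c : ℝ → E := fun t => u + t • (v - u) with hc
  have hcU : ∀ t ∈ Set.Icc (0 : ℝ) 1, c t ∈ U := fun t ht => hU.add_smul_sub_mem hu hv ht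
  have hcd : ∀ t, HasDerivAt c (v - u) t := fun t => by
    have := ((hasDerivAt_id t).smul_const (v - u)).const_add u
    rwa [one_smul] at this
  have hder : ∀ t ∈ Set.Icc (0 : ℝ) 1,
      HasDerivWithinAt (fun t => J (c t)) (inner ℝ (G (c t)) (v - u)) (Set.Icc 0 1) t := by
    intro t ht
    have := (hG (c t) (hcU t ht)).comp_hasDerivWithinAt t (hcd t).hasDerivWithinAt
      (fun s hs => hcU s hs)
    exact this
  set B : ℝ → ℝ := fun t => J u + t * inner ℝ (G u) (v - u) + L / 2 * ‖v - u‖ ^ 2 * t ^ 2 with hB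
  have hBd : ∀ t, HasDerivAt B (inner ℝ (G u) (v - u) + L * ‖v - u‖ ^ 2 * t) t := by
    intro t
    have h1 := ((hasDerivAt_id t).mul_const (inner ℝ (G u) (v - u))).const_add (J u)
    have h2 := ((hasDerivAt_id t).pow 2).const_mul (L / 2 * ‖v - u‖ ^ 2)
    refine (h1.add h2).congr_deriv ?_
    simp only [id_eq, Nat.cast_ofNat]
    ring
  have hle := image_le_of_deriv_right_le_deriv_boundary
    (f := fun t => J (c t)) (f' := fun t => inner ℝ (G (c t)) (v - u)) (a := 0) (b := 1)
    (fun t ht => (hder t ht).continuousWithinAt)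
    (fun t ht => by
      refine (hder t ⟨ht.1, ht.2.le⟩).mono_of_mem_nhdsWithin ?_
      exact mem_of_superset (Ico_mem_nhdsGE ht.2)
        (Set.Ico_subset_Icc_self.trans (Set.Icc_subset_Icc_left ht.1)))
    (B := B) (by simp [hB, hc])
    (fun t _ => (hBd t).continuousAt.continuousWithinAt)
    (fun t _ => (hBd t).hasDerivWithinAt)
    (fun t ht => by
      have h1 := hsmooth (c t) (hcU t ⟨ht.1, ht.2.le⟩) u hu
      have h2 : ‖c t - u‖ = t * ‖v - u‖ := by
        simp [hc, norm_smul, abs_of_nonneg ht.1]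
      have h3 := real_inner_le_norm (G (c t) - G u) (v - u)
      rw [h2] at h1
      rw [inner_sub_left] at h3
      nlinarith [mul_le_mul_of_nonneg_right h1 (norm_nonneg (v - u))])
    (Set.right_mem_Icc.2 zero_le_one)
  simp only [hc, hB] at hle
  simpa using hle

theorem IsGradientOn.continuousOn {J : E → ℝ} {G : E → E} (hG : IsGradientOn J G U) :
    ContinuousOn J U :=
  fun u hu => (hG u hu).continuousWithinAt

/-- On a convex set, two gradients of the same function differ only by vectors orthogonal to the
set. -/
theorem IsGradientOn.inner_sub_eq (hU : Convex ℝ U) {J : E → ℝ} {G G' : E → E}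
    (hG : IsGradientOn J G U) (hG' : IsGradientOn J G' U) {u v w : E} (hu : u ∈ U) (hv : v ∈ U)
    (hw : w ∈ U) : inner ℝ (G u) (v - w) = inner ℝ (G' u) (v - w) := by
  have key : ∀ z ∈ U, inner ℝ (G u) (z - u) = inner ℝ (G' u) (z - u) := fun z hz => by
    simpa using (hG u hu).unique_on (hG' u hu)
      (mem_tangentConeAt_of_segment_subset (hU.segment_subset hu hz))
  rw [← sub_sub_sub_cancel_right v w u, inner_sub_right, inner_sub_right (G' u), key v hv,
    key w hw]

/-! ### Projected descent with vanishing gradient errors -/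

/-- One projected step along a gradient perturbed by `e` decreases the objective, up to an error
of the order of `‖e‖` times the step length. -/
theorem le_sub_of_isProj (hU : Convex ℝ U) {J : E → ℝ} {G : E → E} (hG : IsGradientOn J G U)
    {L : ℝ} (hsmooth : ∀ u ∈ U, ∀ v ∈ U, ‖G u - G v‖ ≤ L * ‖u - v‖) {τ : ℝ} (hτ : 0 < τ)
    {u u' d e : E} (hu : u ∈ U) (hstep : IsProj U (u - τ • d) u')
    (hd : ∀ v ∈ U, ∀ w ∈ U, inner ℝ d (v - w) = inner ℝ (G u + e) (v - w)) :
    J u' ≤ J u - (1 / τ - L / 2) * ‖u' - u‖ ^ 2 + ‖e‖ * ‖u' - u‖ := by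
  obtain ⟨hu', hvi⟩ := (isProj_iff_inner_le_zero hU).1 hstep
  have h1 := hvi u hu
  have h2 : inner ℝ (u - τ • d - u') (u - u') = ‖u' - u‖ ^ 2 + τ * inner ℝ d (u' - u) := by
    rw [← real_inner_self_eq_norm_sq]
    simp only [inner_sub_left, inner_sub_right, real_inner_smul_left]
    ring
  have h3 := hG.le_quadratic hU hsmooth hu hu'
  have h4 := hd u' hu' u hu
  rw [inner_add_left] at h4
  have h5 := (abs_le.1 (abs_real_inner_le_norm e (u' - u))).1
  have h6 : inner ℝ d (u' - u) ≤ -(1 / τ * ‖u' - u‖ ^ 2) := by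
    rw [h2] at h1
    have : 1 / τ * (‖u' - u‖ ^ 2 + τ * inner ℝ d (u' - u)) ≤ 0 :=
      mul_nonpos_of_nonneg_of_nonpos (by positivity) h1
    rw [mul_add, ← mul_assoc, one_div_mul_cancel hτ.ne', one_mul] at this
    linarith
  linarith

/-- If, along a filter, the gradient errors and the step lengths of projected steps vanish, then
limits of the iterates are stationary. -/
theorem mem_stationaryPoints_of_tendsto {ι : Type*} {l : Filter ι} [l.NeBot]
    (hUc : IsClosed U) (hU : Convex ℝ U) {G : E → E} (hGc : ContinuousOn G U) {τ : ℝ}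
    (hτ : 0 < τ) {u u' d e : ι → E} (hu : ∀ i, u i ∈ U)
    (hstep : ∀ i, IsProj U (u i - τ • d i) (u' i))
    (hd : ∀ i, ∀ v ∈ U, ∀ w ∈ U, inner ℝ (d i) (v - w) = inner ℝ (G (u i) + e i) (v - w))
    (he : Tendsto e l (𝓝 0)) (hdiff : Tendsto (fun i => u' i - u i) l (𝓝 0)) {p : E}
    (hup : Tendsto u l (𝓝 p)) : p ∈ stationaryPoints U G := by
  have hp : p ∈ U := hUc.mem_of_tendsto hup (Eventually.of_forall hu)
  have hGu : Tendsto (fun i => G (u i)) l (𝓝 (G p)) :=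
    (hGc p hp).tendsto.comp (tendsto_nhdsWithin_iff.2 ⟨hup, Eventually.of_forall hu⟩)
  have hu'p : Tendsto u' l (𝓝 p) := by simpa using hdiff.add hup
  refine (mem_stationaryPoints_iff hU).2 ⟨hp, fun v hv => ?_⟩
  have hlim : Tendsto (fun i => inner ℝ (u i - u' i) (v - u' i)
      - τ * inner ℝ (G (u i) + e i) (v - u' i)) l
      (𝓝 (inner ℝ (p - p) (v - p) - τ * inner ℝ (G p + 0) (v - p))) :=
    ((hup.sub hu'p).inner (tendsto_const_nhds.sub hu'p)).sub
      (((hGu.add he).inner (tendsto_const_nhds.sub hu'p)).const_mul τ)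
  have hle := le_of_tendsto hlim (b := 0) (Eventually.of_forall fun i => by
    obtain ⟨hu', hvi⟩ := (isProj_iff_inner_le_zero hU).1 (hstep i)
    have := hvi v hv
    rw [sub_right_comm, inner_sub_left, real_inner_smul_left, hd i v hv _ hu'] at this
    exact this)
  rw [sub_self, inner_zero_left, add_zero, zero_sub] at hle
  exact nonneg_of_mul_nonneg_right (by linarith) hτ

/-- A sequence in a compact set whose increments vanish and whose cluster points lie in a finite
set converges to a point of that set. -/
theorem exists_tendsto_of_finite_clusterPts {E : Type*} [NormedAddCommGroup E]
    {U : Set E} {u : ℕ → E} (hUc : IsCompact U) (hu : ∀ n, u n ∈ U)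
    (hdiff : Tendsto (fun n => u (n + 1) - u n) atTop (𝓝 0)) {S : Set E} (hS : S.Finite)
    (hcl : ∀ l : Ultrafilter ℕ, (l : Filter ℕ) ≤ atTop → ∀ p, Tendsto u l (𝓝 p) → p ∈ S) :
    ∃ p ∈ S, Tendsto u atTop (𝓝 p) := by
  have hlim : ∀ l : Ultrafilter ℕ, ∃ p ∈ U, Tendsto u l (𝓝 p) := fun l =>
    hUc.ultrafilter_le_nhds (l.map u)
      (tendsto_principal.2 (Eventually.of_forall hu) : Tendsto u l (𝓟 U))
  obtain ⟨p, -, hp⟩ := hlim (Ultrafilter.of atTop)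
  have hpS : p ∈ S := hcl _ (Ultrafilter.of_le _) p hp
  -- `p` is isolated in `S`
  obtain ⟨r, hr, hball⟩ : ∃ r > 0, ∀ q ∈ S, dist q p < r → q = p := by
    have : (S \ {p})ᶜ ∈ 𝓝 p := (hS.subset Set.sdiff_subset).isClosed.isOpen_compl.mem_nhds (by simp)
    obtain ⟨r, hr, h⟩ := Metric.mem_nhds_iff.1 this
    refine ⟨r, hr, fun q hq hqp => ?_⟩
    have := h (Metric.mem_ball.2 hqp)
    simp only [Set.mem_compl_iff, Set.mem_sdiff, hq, true_and, Set.mem_singleton_iff,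
      not_not] at this
    exact this
  -- the iterates eventually avoid an annulus around `p`
  have hann : ∀ᶠ n in atTop, ¬ (r / 4 ≤ dist (u n) p ∧ dist (u n) p ≤ r / 2) := by
    by_contra hcon
    rw [not_eventually] at hcon
    simp only [not_not] at hcon
    have := frequently_iff_neBot.1 hcon
    let l := Ultrafilter.of (atTop ⊓ 𝓟 {n | r / 4 ≤ dist (u n) p ∧ dist (u n) p ≤ r / 2})
    have hl := Ultrafilter.of_le
      (atTop ⊓ 𝓟 {n | r / 4 ≤ dist (u n) p ∧ dist (u n) p ≤ r / 2})
    obtain ⟨q, -, hq⟩ := hlim l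
    have hqS := hcl l (hl.trans inf_le_left) q hq
    have hev : ∀ᶠ n in (l : Filter ℕ), r / 4 ≤ dist (u n) p ∧ dist (u n) p ≤ r / 2 :=
      le_principal_iff.1 (hl.trans inf_le_right)
    have hdist : Tendsto (fun n => dist (u n) p) l (𝓝 (dist q p)) :=
      hq.dist tendsto_const_nhds
    have h1 := ge_of_tendsto hdist (hev.mono fun n h => h.1)
    have h2 := le_of_tendsto hdist (hev.mono fun n h => h.2)
    have := hball q hqS (by linarith)
    rw [this, dist_self] at h1
    linarith
  have hsmall : ∀ᶠ n in atTop, dist (u (n + 1)) (u n) < r / 4 := by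
    filter_upwards [hdiff.eventually (Metric.ball_mem_nhds 0 (by positivity : 0 < r / 4))] with n hn
    simpa [dist_eq_norm] using hn
  obtain ⟨N, hN⟩ := eventually_atTop.1 (hann.and hsmall)
  obtain ⟨m, hmN, hm⟩ : ∃ m ≥ N, dist (u m) p < r / 4 := by
    have hev : ∀ᶠ n in ((Ultrafilter.of atTop : Ultrafilter ℕ) : Filter ℕ),
        N ≤ n ∧ dist (u n) p < r / 4 :=
      ((eventually_ge_atTop N).filter_mono (Ultrafilter.of_le _)).and
        (hp.eventually (Metric.ball_mem_nhds p (by positivity : 0 < r / 4)))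
    exact hev.exists
  -- hence they cannot leave the ball inside the annulus once the increments are shorter than its width
  have hstay : ∀ n ≥ m, dist (u n) p < r / 4 := by
    intro n hn
    induction n, hn using Nat.le_induction with
    | base => exact hm
    | succ n hn ih =>
      by_contra! hge
      refine (hN (n + 1) (by omega)).1 ⟨hge, ?_⟩
      linarith [dist_triangle (u (n + 1)) (u n) p, (hN n (by omega)).2]
  refine ⟨p, hpS, (tendsto_iff_ultrafilter _ _ _).2 fun l hl => ?_⟩
  obtain ⟨q, -, hq⟩ := hlim l
  have h2 := le_of_tendsto (hq.dist tendsto_const_nhds)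
    (((eventually_ge_atTop m).filter_mono hl).mono fun n hn => (hstay n hn).le)
  rwa [hball q (hcl l hl q hq) (by linarith)] at hq

/-- Projected gradient steps of constant size `τ < 2 / L`, with gradient errors `e n → 0` that need
not be summable, converge to a stationary point as soon as there are only finitely many of those. -/
theorem exists_tendsto_of_error_tendsto_zero (hUc : IsCompact U) (hU : Convex ℝ U) {J : E → ℝ}
    {G : E → E} (hG : IsGradientOn J G U) {L : ℝ} (hL : 0 < L)
    (hsmooth : ∀ u ∈ U, ∀ v ∈ U, ‖G u - G v‖ ≤ L * ‖u - v‖)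
    (hfin : (stationaryPoints U G).Finite) {τ : ℝ} (hτpos : 0 < τ) (hτ : τ < 2 / L)
    {u d e : ℕ → E} (hu : ∀ n, u n ∈ U) (hstep : ∀ n, IsProj U (u n - τ • d n) (u (n + 1)))
    (hd : ∀ n, ∀ v ∈ U, ∀ w ∈ U, inner ℝ (d n) (v - w) = inner ℝ (G (u n) + e n) (v - w))
    (he : Tendsto e atTop (𝓝 0)) :
    ∃ p ∈ stationaryPoints U G, Tendsto u atTop (𝓝 p) := by
  have hJc : ContinuousOn J U := hG.continuousOn
  have hGc : ContinuousOn G U :=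
    (LipschitzOnWith.of_dist_le_mul (K := ⟨L, hL.le⟩) fun x hx y hy => by
      rw [dist_eq_norm, dist_eq_norm]
      exact hsmooth x hx y hy).continuousOn
  obtain ⟨c, hc0, hc⟩ : ∃ c, 0 < c ∧ c = 1 / τ - L / 2 := by
    refine ⟨_, ?_, rfl⟩
    rw [lt_div_iff₀ hL] at hτ
    rw [sub_pos, lt_div_iff₀ hτpos]
    linarith
  have hdec : ∀ n, J (u (n + 1))
      ≤ J (u n) - c * ‖u (n + 1) - u n‖ ^ 2 + ‖e n‖ * ‖u (n + 1) - u n‖ := fun n =>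
    hc ▸ le_sub_of_isProj hU hG hsmooth hτpos (hu n) (hstep n) (hd n)
  obtain ⟨R, hR⟩ : ∃ R, ∀ n, ‖u (n + 1) - u n‖ ≤ R := by
    obtain ⟨R, hR⟩ := hUc.isBounded.exists_norm_le
    exact ⟨R + R, fun n => (norm_sub_le _ _).trans (add_le_add (hR _ (hu _)) (hR _ (hu _)))⟩
  have herr : Tendsto (fun n => ‖e n‖ * ‖u (n + 1) - u n‖) atTop (𝓝 0) := by
    refine squeeze_zero (fun n => by positivity)
      (fun n => mul_le_mul_of_nonneg_left (hR n) (norm_nonneg _)) ?_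
    simpa using he.norm.mul_const R
  -- between levels that are not attained at stationary points, steps eventually do not ascend
  have hlevel : ∀ a b : ℝ, (∀ p ∈ stationaryPoints U G, ¬ (a ≤ J p ∧ J p ≤ b)) →
      ∀ᶠ n in atTop, a ≤ J (u n) → J (u n) ≤ b → J (u (n + 1)) ≤ J (u n) := by
    intro a b hab
    by_contra hcon
    rw [not_eventually] at hcon
    have := frequently_iff_neBot.1 hcon
    set A := {n | ¬ (a ≤ J (u n) → J (u n) ≤ b → J (u (n + 1)) ≤ J (u n))} with hA
    let l := Ultrafilter.of (atTop ⊓ 𝓟 A)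
    have hl : (l : Filter ℕ) ≤ atTop ⊓ 𝓟 A := Ultrafilter.of_le _
    have hev : ∀ᶠ n in (l : Filter ℕ),
        (a ≤ J (u n) ∧ J (u n) ≤ b) ∧ J (u n) < J (u (n + 1)) := by
      have h : ∀ᶠ n in (l : Filter ℕ), n ∈ A := le_principal_iff.1 (hl.trans inf_le_right)
      filter_upwards [h] with n hn
      simp only [hA, Set.mem_ofPred_eq] at hn
      push Not at hn
      exact ⟨⟨hn.1, hn.2.1⟩, hn.2.2⟩
    have hel : Tendsto e l (𝓝 0) := he.mono_left (hl.trans inf_le_left)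
    obtain ⟨p, hpU, hp⟩ := hUc.ultrafilter_le_nhds (l.map u)
      (tendsto_principal.2 (Eventually.of_forall hu) : Tendsto u l (𝓟 U))
    -- an ascending step is not longer than a multiple of its gradient error
    have hdl : Tendsto (fun n => u (n + 1) - u n) l (𝓝 0) := by
      refine squeeze_zero_norm' (a := fun n => ‖e n‖ / c) ?_ (by simpa using hel.norm.div_const c)
      filter_upwards [hev] with n hn
      rw [le_div_iff₀ hc0]
      by_contra! hlt
      nlinarith [hdec n, norm_nonneg (u (n + 1) - u n), norm_nonneg (e n)]
    have hps := mem_stationaryPoints_of_tendsto (l := (l : Filter ℕ)) hUc.isClosed hU hGc hτpos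
      hu hstep hd hel hdl hp
    have hJp : Tendsto (fun n => J (u n)) l (𝓝 (J p)) :=
      (hJc p hpU).tendsto.comp (tendsto_nhdsWithin_iff.2 ⟨hp, Eventually.of_forall hu⟩)
    exact hab p hps ⟨ge_of_tendsto hJp (hev.mono fun n h => h.1.1),
      le_of_tendsto hJp (hev.mono fun n h => h.1.2)⟩
  obtain ⟨J₀, hJ₀⟩ : ∃ C, ∀ n, |J (u n)| ≤ C := by
    obtain ⟨C, hC⟩ := hUc.exists_bound_of_continuousOn hJc
    exact ⟨C, fun n => hC _ (hu n)⟩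
  obtain ⟨Jlim, hJlim⟩ : ∃ y, Tendsto (fun n => J (u n)) atTop (𝓝 y) := by
    refine tendsto_of_no_upcrossings dense_univ ?_
      (isBoundedUnder_of ⟨J₀, fun n => (abs_le.1 (hJ₀ n)).2⟩)
      (isBoundedUnder_of ⟨-J₀, fun n => (abs_le.1 (hJ₀ n)).1⟩)
    rintro a - b - hab ⟨hfa, hfb⟩
    obtain ⟨a', b', ha', hab', hb', hempty⟩ : ∃ a' b', a < a' ∧ a' < b' ∧ b' < b ∧
        ∀ p ∈ stationaryPoints U G, ¬ (a' ≤ J p ∧ J p ≤ b') := by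
      have hV : (J '' stationaryPoints U G).Finite := hfin.image J
      obtain ⟨y, hy, hyV⟩ := ((Set.Ioo_infinite hab).sdiff hV).nonempty
      have : Set.Ioo a b ∩ (J '' stationaryPoints U G)ᶜ ∈ 𝓝 y :=
        inter_mem (isOpen_Ioo.mem_nhds hy) (hV.isClosed.isOpen_compl.mem_nhds hyV)
      obtain ⟨r, hr, hsub⟩ := Metric.nhds_basis_closedBall.mem_iff.1 this
      rw [Real.closedBall_eq_Icc] at hsub
      refine ⟨y - r, y + r, (hsub ⟨le_rfl, by linarith⟩).1.1, by linarith,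
        (hsub ⟨by linarith, le_rfl⟩).1.2, fun p hp hJp => (hsub hJp).2 ⟨p, hp, rfl⟩⟩
    have hsmall := herr.eventually (gt_mem_nhds (sub_pos.2 hab'))
    obtain ⟨N, hN⟩ := eventually_atTop.1 ((hlevel a' b' hempty).and hsmall)
    obtain ⟨m, hmN, hm⟩ := (frequently_atTop.1 hfa) N
    -- the band cannot be jumped over, and inside it the objective does not increase
    have hstay : ∀ n ≥ m, J (u n) ≤ b' := by
      intro n hn
      induction n, hn using Nat.le_induction with
      | base => linarith
      | succ n hn ih =>
        obtain ⟨h1, h2⟩ := hN n (by omega)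
        by_cases h : a' ≤ J (u n)
        · exact (h1 h ih).trans ih
        · have := hdec n
          nlinarith [sq_nonneg ‖u (n + 1) - u n‖]
    obtain ⟨n, hn, hbn⟩ := (frequently_atTop.1 hfb) m
    linarith [hstay n hn]
  have hdiff : Tendsto (fun n => u (n + 1) - u n) atTop (𝓝 0) := by
    have hsq : Tendsto (fun n => ‖u (n + 1) - u n‖ ^ 2) atTop (𝓝 0) := by
      have h1 : Tendsto (fun n => (J (u n) - J (u (n + 1)) + ‖e n‖ * ‖u (n + 1) - u n‖) / c)
          atTop (𝓝 0) := by
        simpa using ((hJlim.sub (hJlim.comp (tendsto_add_atTop_nat 1))).add herr).div_const c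
      refine squeeze_zero (fun n => by positivity) (fun n => ?_) h1
      rw [le_div_iff₀ hc0]
      linarith [hdec n]
    have := (Real.continuous_sqrt.tendsto 0).comp hsq
    rw [Real.sqrt_zero] at this
    refine tendsto_zero_iff_norm_tendsto_zero.2 (this.congr fun n => ?_)
    simp [Real.sqrt_sq]
  exact exists_tendsto_of_finite_clusterPts hUc hu hdiff hfin fun l hl p hp =>
    mem_stationaryPoints_of_tendsto (l := (l : Filter ℕ)) hUc.isClosed hU hGc hτpos hu hstep hd
      (he.mono_left hl) (hdiff.mono_left hl) hp

end Optimization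

/-! ### Differentiation under the integral relative to the admissible set -/

section Objective

variable {E : Type*} [NormedAddCommGroup E] [InnerProductSpace ℝ E]
variable {F : Type*} [NormedAddCommGroup F]

theorem integrable_of_continuousOn_of_ae_mem [MeasurableSpace F] [OpensMeasurableSpace F]
    {H : Type*} [NormedAddCommGroup H] {μ : Measure F} [IsFiniteMeasure μ] {S : Set F}
    (hS : IsCompact S) (hμS : ∀ᵐ y ∂μ, y ∈ S) {f : F → H} (hf : ContinuousOn f S) :
    Integrable f μ := by
  rw [← Measure.restrict_eq_self_of_ae_mem hμS]
  exact hf.integrableOn_compact hS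

/-- The integral of the partial gradient is a gradient of the objective. Gradients being relative
to `U`, the first-order expansion of the integrand is bounded uniformly in the parameter by the
mean value inequality on the convex set `U`, and then integrated. -/
theorem isGradientOn_objective [CompleteSpace E] [MeasurableSpace F] [OpensMeasurableSpace F]
    {μ : Measure F} [IsProbabilityMeasure μ] {U : Set E} (hUc : IsCompact U) (hU : Convex ℝ U)
    {S X : Set F} (hS : IsCompact S) (hSX : S ⊆ X) (hμS : ∀ᵐ y ∂μ, y ∈ S) {j : E → F → ℝ}
    (hj : ContinuousOn (fun p : E × F => j p.1 p.2) (U ×ˢ S)) {g : E → F → E}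
    (hg : ∀ y ∈ S, IsGradientOn (fun u => j u y) (fun u => g u y) U)
    (hgc : ContinuousOn (fun p : E × F => g p.1 p.2) (U ×ˢ S)) :
    IsGradientOn (objective j X μ) (fun u => ∫ y, g u y ∂μ) U := by
  have hobj : ∀ u, objective j X μ u = ∫ y, j u y ∂μ := fun u => by
    rw [objective, Measure.restrict_eq_self_of_ae_mem (hμS.mono fun y hy => hSX hy)]
  have hsec : ∀ u ∈ U, ContinuousOn (fun y : F => ((u, y) : E × F)) S := fun u _ => by fun_prop
  have hji : ∀ u ∈ U, Integrable (j u) μ := fun u hu =>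
    integrable_of_continuousOn_of_ae_mem hS hμS
      (hj.comp (hsec u hu) fun y hy => Set.mk_mem_prod hu hy)
  have hgi : ∀ u ∈ U, Integrable (g u) μ := fun u hu =>
    integrable_of_continuousOn_of_ae_mem hS hμS
      (hgc.comp (hsec u hu) fun y hy => Set.mk_mem_prod hu hy)
  intro u hu
  refine HasFDerivWithinAt.of_isLittleO (Asymptotics.isLittleO_iff.2 fun ε hε => ?_)
  obtain ⟨δ, hδ, hunif⟩ := Metric.uniformContinuousOn_iff.1
    ((hUc.prod hS).uniformContinuousOn_of_continuous hgc) ε hε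
  filter_upwards [inter_mem_nhdsWithin U (Metric.ball_mem_nhds u hδ)] with v hv
  have hpt : ∀ y ∈ S, ‖j v y - j u y - inner ℝ (v - u) (g u y)‖ ≤ ε * ‖v - u‖ := by
    intro y hy
    have := Convex.norm_image_sub_le_of_norm_hasFDerivWithin_le'
      (f := fun w => j w y) (f' := fun w => innerSL ℝ (g w y)) (φ := innerSL ℝ (g u y))
      (s := U ∩ Metric.ball u δ) (C := ε)
      (fun w hw => (hg y hy w hw.1).mono Set.inter_subset_left)
      (fun w hw => by
        rw [← map_sub, innerSL_apply_norm, ← dist_eq_norm]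
        refine (hunif (w, y) ⟨hw.1, hy⟩ (u, y) ⟨hu, hy⟩ ?_).le
        simpa [Prod.dist_eq] using hw.2)
      (hU.inter (convex_ball u δ)) ⟨hu, Metric.mem_ball_self hδ⟩ hv
    rwa [innerSL_apply_apply, real_inner_comm] at this
  have hint : objective j X μ v - objective j X μ u
      - innerSL ℝ (∫ y, g u y ∂μ) (v - u)
      = ∫ y, (j v y - j u y - inner ℝ (v - u) (g u y)) ∂μ := by
    have hinn : Integrable (fun y => inner ℝ (v - u) (g u y)) μ := (hgi u hu).const_inner _
    have hsub : Integrable (fun y => j v y - j u y) μ := (hji v hv.1).sub (hji u hu)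
    rw [integral_sub hsub hinn, integral_sub (hji v hv.1) (hji u hu),
      integral_inner (hgi u hu), hobj, hobj, innerSL_apply_apply, real_inner_comm]
  rw [hint]
  simpa using norm_integral_le_of_norm_le_const (μ := μ) (hμS.mono hpt)

end Objective

/-! ### Measurability of the iterates -/

theorem IsCSGSequence.mem {E F : Type*} [NormedAddCommGroup E] [InnerProductSpace ℝ E]
    {U : Set E} {g : E → F → E} {u₀ : E} {τ : ℕ → ℝ} {x : ℕ → F} {α : ℕ → ℕ → ℝ} {u : ℕ → E}
    (h : IsCSGSequence U g u₀ τ x α u) (hu₀ : u₀ ∈ U) (n : ℕ) : u n ∈ U := by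
  cases n with
  | zero => rwa [h.1]
  | succ n => exact (h.2 n).1

section Measurability

variable {E : Type*} [NormedAddCommGroup E] [InnerProductSpace ℝ E] [FiniteDimensional ℝ E]
  [MeasurableSpace E] [BorelSpace E]
variable {F : Type*} [NormedAddCommGroup F] [SecondCountableTopology F]
  [MeasurableSpace F] [BorelSpace F]

/-- The iterates are predictable: `u n` is determined by the information available before the
sample `x n` is drawn. For `n = 0` the index `n - 1` truncates to `0`, which is harmless as `u 0` is
deterministic. -/
theorem IsCSGSequence.measurable {U : Set E} (hUc : IsCompact U) (hU : Convex ℝ U) {X : Set F}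
    {g : E → F → E} (hgc : ContinuousOn (fun p : E × F => g p.1 p.2) (U ×ˢ X))
    {Ω : Type*} {mΩ : MeasurableSpace Ω} {ℱ : Filtration ℕ mΩ} {x : ℕ → Ω → F}
    (hxX : ∀ n ω, x n ω ∈ X) (hx : ∀ n, Measurable[ℱ n] (x n)) {u₀ : E} (hu₀ : u₀ ∈ U)
    {τ : ℕ → ℝ} {α : ℕ → ℕ → Ω → ℝ} (hα : ∀ n k, Measurable[ℱ n] (α n k)) {u : ℕ → Ω → E}
    (hu : ∀ ω, IsCSGSequence U g u₀ τ (fun n => x n ω) (fun n k => α n k ω) (fun n => u n ω))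
    (n : ℕ) : Measurable[ℱ (n - 1)] (u n) := by
  have huU : ∀ n ω, u n ω ∈ U := fun n ω => (hu ω).mem hu₀ n
  have hex : ∀ y, ∃ p, IsProj U y p := fun y =>
    hUc.exists_isMinOn ⟨u₀, hu₀⟩ (continuous_const.sub continuous_id).norm.continuousOn
  choose π hπ using hex
  have hπm : Measurable π := by
    refine (LipschitzWith.of_dist_le_mul (K := 1) fun y z => ?_).continuous.measurable
    simpa [dist_eq_norm] using (hπ y).norm_sub_le hU (hπ z)
  induction n using Nat.strong_induction_on with
  | _ n ih =>
  cases n with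
  | zero =>
    have : u 0 = fun _ => u₀ := funext fun ω => (hu ω).1
    rw [this]
    exact measurable_const
  | succ n =>
    have heq : u (n + 1) = fun ω => π (u n ω - τ n • searchDirection g (fun n => x n ω)
        (fun n => u n ω) (fun n k => α n k ω) n) := by
      funext ω
      refine sub_eq_zero.1 (norm_le_zero_iff.1 ?_)
      exact (((hu ω).2 n).norm_sub_le hU (hπ _)).trans_eq (by rw [sub_self, norm_zero])
    have hum : ∀ k ≤ n, Measurable[ℱ n] (u k) := fun k hk =>
      (ih k (by omega)).mono (ℱ.mono (by omega)) le_rfl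
    rw [heq, Nat.add_sub_cancel]
    refine hπm.comp ((hum n le_rfl).sub (Measurable.const_smul ?_ (τ n)))
    refine Finset.measurable_fun_sum _ fun k hk => ?_
    have hkn : k ≤ n := Nat.lt_succ_iff.1 (Finset.mem_range.1 hk)
    refine (hα n k).smul ?_
    have hpair : Measurable[ℱ n] fun ω =>
        (⟨(u k ω, x k ω), huU k ω, hxX k ω⟩ : (U ×ˢ X : Set (E × F))) :=
      ((hum k hkn).prodMk ((hx k).mono (ℱ.mono hkn) le_rfl)).subtype_mk
    exact (continuousOn_iff_continuous_domRestrict.1 hgc).measurable.comp hpair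

end Measurability

/-! ### Recurrence: the samples become dense near the iterates -/

section Recurrence

/-- If the events `A n` are known before the sample `x n` is drawn, and infinitely many of them
occur, then in infinitely many of these steps the sample hits a given set of positive measure.
This is Lévy's extension of the Borel–Cantelli lemma: the conditional probabilities of the
events `A n ∩ {x n ∈ B}` are `μ B` on `A n`. -/
theorem ae_frequently_mem_and_mem {F : Type*} [MeasurableSpace F] {μ : Measure F}
    {Ω : Type*} {mΩ : MeasurableSpace Ω} {P : Measure Ω} [IsProbabilityMeasure P]
    {ℱ : Filtration ℕ mΩ} {x : ℕ → Ω → F} (hx : ∀ n, Measurable[ℱ n] (x n))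
    (hlaw : ∀ n, P.map (x n) = μ)
    (hindep : ∀ n, Indep (MeasurableSpace.comap (x (n + 1)) inferInstance) (ℱ n) P)
    {A : ℕ → Set Ω} (hA : ∀ n, MeasurableSet[ℱ (n - 1)] (A n)) {B : Set F}
    (hB : MeasurableSet B) (hμB : 0 < μ B) :
    ∀ᵐ ω ∂P, (∃ᶠ n in atTop, ω ∈ A n) → ∃ᶠ n in atTop, ω ∈ A n ∧ x n ω ∈ B := by
  have hxm : ∀ n, Measurable (x n) := fun n => (hx n).mono (ℱ.le n) le_rfl
  have hμfin : IsProbabilityMeasure μ := hlaw 0 ▸ Measure.isProbabilityMeasure_map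
    (hxm 0).aemeasurable
  set s : ℕ → Set Ω := fun n => A n ∩ x n ⁻¹' B with hs
  have hsm : ∀ n, MeasurableSet[ℱ n] (s n) := fun n =>
    (ℱ.mono (Nat.sub_le n 1) _ (hA n)).inter (hx n hB)
  have hce : ∀ k, P[(s (k + 1)).indicator 1 | ℱ k]
      =ᵐ[P] (A (k + 1)).indicator fun _ => μ.real B := by
    intro k
    have hBm : MeasurableSet (x (k + 1) ⁻¹' B) := hxm _ hB
    have h1 : (s (k + 1)).indicator (1 : Ω → ℝ)
        = (A (k + 1)).indicator ((x (k + 1) ⁻¹' B).indicator 1) := by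
      rw [hs, Set.indicator_indicator]
    have hint : Integrable ((x (k + 1) ⁻¹' B).indicator (1 : Ω → ℝ)) P :=
      (integrable_const (1 : ℝ)).indicator hBm
    have h2 : P[(x (k + 1) ⁻¹' B).indicator (1 : Ω → ℝ) | ℱ k]
        =ᵐ[P] fun _ => ∫ ω, (x (k + 1) ⁻¹' B).indicator (1 : Ω → ℝ) ω ∂P := by
      refine condExp_indep_eq (hxm (k + 1)).comap_le (ℱ.le k) ?_ (hindep k)
      exact (stronglyMeasurable_const (β := ℝ)).indicator ⟨B, hB, rfl⟩
    have h3 : ∫ ω, (x (k + 1) ⁻¹' B).indicator (1 : Ω → ℝ) ω ∂P = μ.real B := by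
      rw [integral_indicator_one hBm, ← hlaw (k + 1), map_measureReal_apply (hxm _) hB]
    rw [h1]
    have hAk : MeasurableSet[ℱ k] (A (k + 1)) := hA (k + 1)
    refine (condExp_indicator hint hAk).trans ?_
    filter_upwards [h2] with ω hω
    rw [h3] at hω
    by_cases hωA : ω ∈ A (k + 1)
    · rw [Set.indicator_of_mem hωA, Set.indicator_of_mem hωA, hω]
    · rw [Set.indicator_of_notMem hωA, Set.indicator_of_notMem hωA]
  filter_upwards [ae_mem_limsup_atTop_iff P hsm, ae_all_iff.2 hce] with ω hω hceω hfreq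
  have hmem : ω ∈ limsup s atTop := by
    rw [hω]
    simp_rw [hceω]
    have hpos : 0 < μ.real B := ENNReal.toReal_pos hμB.ne' (measure_ne_top μ B)
    have hinf : {k | ω ∈ A (k + 1)}.Infinite := by
      rw [← Nat.frequently_atTop_iff_infinite]
      rw [frequently_atTop] at hfreq ⊢
      intro N
      obtain ⟨n, hn, hωn⟩ := hfreq (N + 1)
      exact ⟨n - 1, by omega, by rwa [Nat.sub_add_cancel (by omega)]⟩
    refine ((Set.infinite_iff_tendsto_sum_indicator_atTop hpos).1 hinf).congr fun n => ?_
    exact Finset.sum_congr rfl fun k _ => by simp only [Set.indicator, Set.mem_ofPred_eq]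
  rw [mem_limsup_iff_frequently_mem] at hmem
  exact hmem

/-- A deterministic criterion for the sampled pairs `(u k, x k)`, `k ≤ n`, to become dense around
`{u n} × S`, uniformly on the compact set `S`. -/
theorem eventually_forall_exists_near {E : Type*} [SeminormedAddCommGroup E]
    [TopologicalSpace.SeparableSpace E] {F : Type*} [SeminormedAddCommGroup F]
    [TopologicalSpace.SeparableSpace F] {U : Set E} {S : Set F} (hUc : IsCompact U)
    (hS : IsCompact S) {u : ℕ → E} {x : ℕ → F} (hu : ∀ n, u n ∈ U)
    (hrec : ∀ i j m : ℕ,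
      (∃ᶠ n in atTop, u n ∈ Metric.ball (TopologicalSpace.denseSeq E i) (1 / ((m : ℝ) + 1))) →
      (Metric.ball (TopologicalSpace.denseSeq F j) (1 / ((m : ℝ) + 1)) ∩ S).Nonempty →
      ∃ k, u k ∈ Metric.ball (TopologicalSpace.denseSeq E i) (1 / ((m : ℝ) + 1)) ∧
        x k ∈ Metric.ball (TopologicalSpace.denseSeq F j) (1 / ((m : ℝ) + 1)))
    {ε : ℝ} (hε : 0 < ε) :
    ∀ᶠ n in atTop, ∀ y ∈ S, ∃ k ≤ n, ‖u n - u k‖ + ‖y - x k‖ < ε := by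
  obtain ⟨m, hm⟩ := exists_nat_one_div_lt (show 0 < ε / 4 by positivity)
  set r : ℝ := 1 / ((m : ℝ) + 1) with hr
  have hr0 : 0 < r := Nat.one_div_pos_of_nat
  have hcovE : ∀ p : E, ∃ i, p ∈ Metric.ball (TopologicalSpace.denseSeq E i) r := fun p => by
    obtain ⟨i, hd⟩ := (TopologicalSpace.denseRange_denseSeq E).exists_dist_lt p hr0
    exact ⟨_, hd⟩
  have hcovF : ∀ p : F, ∃ i, p ∈ Metric.ball (TopologicalSpace.denseSeq F i) r := fun p => by
    obtain ⟨i, hd⟩ := (TopologicalSpace.denseRange_denseSeq F).exists_dist_lt p hr0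
    exact ⟨_, hd⟩
  obtain ⟨I, hI⟩ := hUc.elim_finite_subcover _
    (fun i => Metric.isOpen_ball (x := TopologicalSpace.denseSeq E i) (ε := r))
    (fun p _ => Set.mem_iUnion.2 (hcovE p))
  obtain ⟨K, hK⟩ := hS.elim_finite_subcover _
    (fun i => Metric.isOpen_ball (x := TopologicalSpace.denseSeq F i) (ε := r))
    (fun p _ => Set.mem_iUnion.2 (hcovF p))
  have hev : ∀ i ∈ I, ∀ j ∈ K, ∀ᶠ n in atTop,
      u n ∈ Metric.ball (TopologicalSpace.denseSeq E i) r →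
      (Metric.ball (TopologicalSpace.denseSeq F j) r ∩ S).Nonempty →
      ∃ k ≤ n, u k ∈ Metric.ball (TopologicalSpace.denseSeq E i) r ∧
        x k ∈ Metric.ball (TopologicalSpace.denseSeq F j) r := by
    intro i _ j _
    by_cases hfr : ∃ᶠ n in atTop, u n ∈ Metric.ball (TopologicalSpace.denseSeq E i) r
    · by_cases hne : (Metric.ball (TopologicalSpace.denseSeq F j) r ∩ S).Nonempty
      · obtain ⟨k, hk⟩ := hrec i j m hfr hne
        filter_upwards [eventually_ge_atTop k] with n hn _ _ using ⟨k, hn, hk⟩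
      · exact Eventually.of_forall fun n _ h => absurd h hne
    · filter_upwards [not_frequently.1 hfr] with n hn h _ using absurd h hn
  have hev' : ∀ᶠ n in atTop, ∀ i ∈ I, ∀ j ∈ K,
      u n ∈ Metric.ball (TopologicalSpace.denseSeq E i) r →
      (Metric.ball (TopologicalSpace.denseSeq F j) r ∩ S).Nonempty →
      ∃ k ≤ n, u k ∈ Metric.ball (TopologicalSpace.denseSeq E i) r ∧
        x k ∈ Metric.ball (TopologicalSpace.denseSeq F j) r :=
    (eventually_all_finset I).2 fun i hi => (eventually_all_finset K).2 fun j hj => hev i hi j hj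
  filter_upwards [hev'] with n hn y hy
  obtain ⟨i, hi, hui⟩ := Set.mem_iUnion₂.1 (hI (hu n))
  obtain ⟨j, hj, hyj⟩ := Set.mem_iUnion₂.1 (hK hy)
  obtain ⟨k, hk, huk, hxk⟩ := hn i hi j hj hui ⟨y, hyj, hy⟩
  refine ⟨k, hk, ?_⟩
  rw [← dist_eq_norm, ← dist_eq_norm]
  have h1 := dist_triangle_right (u n) (u k) (TopologicalSpace.denseSeq E i)
  have h2 := dist_triangle_right y (x k) (TopologicalSpace.denseSeq F j)
  rw [Metric.mem_ball] at hui hyj huk hxk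
  linarith

/-- Almost surely, every point of the support of `μ`, paired with the current iterate, has an
arbitrarily near neighbour among the sampled pairs, uniformly on the support. -/
theorem ae_eventually_forall_exists_near {E : Type*} [NormedAddCommGroup E]
    [TopologicalSpace.SeparableSpace E] [MeasurableSpace E] [BorelSpace E] {F : Type*}
    [NormedAddCommGroup F] [TopologicalSpace.SeparableSpace F] [MeasurableSpace F] [BorelSpace F]
    {μ : Measure F} {U : Set E} (hUc : IsCompact U) (hS : IsCompact μ.support)
    {Ω : Type*} {mΩ : MeasurableSpace Ω} {P : Measure Ω} [IsProbabilityMeasure P]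
    {ℱ : Filtration ℕ mΩ} {x : ℕ → Ω → F} (hx : ∀ n, Measurable[ℱ n] (x n))
    (hlaw : ∀ n, P.map (x n) = μ)
    (hindep : ∀ n, Indep (MeasurableSpace.comap (x (n + 1)) inferInstance) (ℱ n) P)
    {u : ℕ → Ω → E} (hu : ∀ n ω, u n ω ∈ U) (hum : ∀ n, Measurable[ℱ (n - 1)] (u n)) :
    ∀ᵐ ω ∂P, ∀ ε > 0, ∀ᶠ n in atTop, ∀ y ∈ μ.support, ∃ k ≤ n,
      ‖u n ω - u k ω‖ + ‖y - x k ω‖ < ε := by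
  have hall : ∀ᵐ ω ∂P, ∀ i j m : ℕ,
      (∃ᶠ n in atTop, u n ω ∈ Metric.ball (TopologicalSpace.denseSeq E i) (1 / ((m : ℝ) + 1))) →
      (Metric.ball (TopologicalSpace.denseSeq F j) (1 / ((m : ℝ) + 1)) ∩ μ.support).Nonempty →
      ∃ k, u k ω ∈ Metric.ball (TopologicalSpace.denseSeq E i) (1 / ((m : ℝ) + 1)) ∧
        x k ω ∈ Metric.ball (TopologicalSpace.denseSeq F j) (1 / ((m : ℝ) + 1)) := by
    refine ae_all_iff.2 fun i => ae_all_iff.2 fun j => ae_all_iff.2 fun m => ?_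
    by_cases hne :
        (Metric.ball (TopologicalSpace.denseSeq F j) (1 / ((m : ℝ) + 1)) ∩ μ.support).Nonempty
    · obtain ⟨y, hy, hyS⟩ := hne
      filter_upwards [ae_frequently_mem_and_mem hx hlaw hindep
        (A := fun n => u n ⁻¹' Metric.ball (TopologicalSpace.denseSeq E i) (1 / ((m : ℝ) + 1)))
        (fun n => hum n measurableSet_ball) measurableSet_ball
        (Measure.mem_support_iff_forall y |>.1 hyS _ (Metric.isOpen_ball.mem_nhds hy))]
        with ω hω hfr _
      exact (hω hfr).exists
    · exact Eventually.of_forall fun ω _ h => absurd h hne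
  filter_upwards [hall] with ω hω ε hε
  exact eventually_forall_exists_near hUc hS (fun n => hu n ω) hω hε

end Recurrence

/-! ### Convergence of the reference measures on countably many test functions -/

section Reference

theorem pairwise_indepFun_of_indep_filtration {F : Type*} [MeasurableSpace F] {Ω : Type*}
    {mΩ : MeasurableSpace Ω} {P : Measure Ω} {ℱ : Filtration ℕ mΩ} {x : ℕ → Ω → F}
    (hx : ∀ n, Measurable[ℱ n] (x n))
    (hindep : ∀ n, Indep (MeasurableSpace.comap (x (n + 1)) inferInstance) (ℱ n) P) :
    Pairwise (Function.onFun (fun f g => IndepFun f g P) x) := by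
  have key : ∀ m n, m < n → IndepFun (x n) (x m) P := by
    intro m n hmn
    obtain ⟨n, rfl⟩ : ∃ k, n = k + 1 := ⟨n - 1, by omega⟩
    rw [IndepFun_iff_Indep]
    exact indep_of_indep_of_le_right (hindep n)
      ((hx m).mono (ℱ.mono (Nat.lt_succ_iff.1 hmn)) le_rfl).comap_le
  intro m n hmn
  rcases lt_or_gt_of_ne hmn with h | h
  · exact (key m n h).symm
  · exact key n m h

theorem ae_tendsto_average {F : Type*} [MeasurableSpace F] {μ : Measure F} {Ω : Type*}
    {mΩ : MeasurableSpace Ω} {P : Measure Ω} {ℱ : Filtration ℕ mΩ} {x : ℕ → Ω → F}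
    (hx : ∀ n, Measurable[ℱ n] (x n)) (hlaw : ∀ n, P.map (x n) = μ)
    (hindep : ∀ n, Indep (MeasurableSpace.comap (x (n + 1)) inferInstance) (ℱ n) P)
    {f : F → ℝ} (hf : Measurable f) (hfi : Integrable f μ) :
    ∀ᵐ ω ∂P, Tendsto (fun n : ℕ => (∑ i ∈ Finset.range n, f (x i ω)) / n) atTop
      (𝓝 (∫ y, f y ∂μ)) := by
  have hxm : ∀ n, Measurable (x n) := fun n => (hx n).mono (ℱ.le n) le_rfl
  have hint : ∫ ω, f (x 0 ω) ∂P = ∫ y, f y ∂μ := by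
    rw [← hlaw 0, integral_map (hxm 0).aemeasurable hf.aestronglyMeasurable]
  rw [← hint]
  refine strong_law_ae_real (fun i ω => f (x i ω)) ?_ ?_ ?_
  · rw [← hlaw 0] at hfi
    exact hfi.comp_measurable (hxm 0)
  · exact fun m n hmn => (pairwise_indepFun_of_indep_filtration hx hindep hmn).comp hf hf
  · intro i
    exact IdentDistrib.comp ⟨(hxm i).aemeasurable, (hxm 0).aemeasurable, by rw [hlaw, hlaw]⟩ hf

variable {F : Type*} [NormedAddCommGroup F] [MeasurableSpace F] {μ : Measure F} {x : ℕ → F}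
  {ν : ℕ → Measure F}

theorem IsReferenceMeasure.isProbabilityMeasure [IsProbabilityMeasure μ]
    (h : IsReferenceMeasure μ x ν) (n : ℕ) : IsProbabilityMeasure (ν n) := by
  rcases h with h | h | h
  · rw [h n]; infer_instance
  · rw [h n]
    constructor
    simp only [Measure.smul_apply, Measure.finsetSum_apply, measure_univ, Finset.sum_const,
      Finset.card_range, smul_eq_mul, nsmul_eq_mul, mul_one, Nat.cast_add, Nat.cast_one]
    exact ENNReal.inv_mul_cancel (by positivity) (by finiteness)
  · exact h.1 n

/-- The reference measures converge on any test function on which the empirical averages do. -/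
theorem IsReferenceMeasure.tendsto_integral [OpensMeasurableSpace F]
    (h : IsReferenceMeasure μ x ν) (f : F →ᵇ ℝ)
    (hf : Tendsto (fun n : ℕ => (∑ i ∈ Finset.range n, f (x i)) / n) atTop (𝓝 (∫ y, f y ∂μ))) :
    Tendsto (fun n => ∫ y, f y ∂(ν n)) atTop (𝓝 (∫ y, f y ∂μ)) := by
  rcases h with h | h | h
  · simp only [h]
    exact tendsto_const_nhds
  · refine (hf.comp (tendsto_add_atTop_nat 1)).congr fun n => ?_
    rw [h n, integral_smul_measure, integral_finsetSum_measure]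
    · have hd : ∀ i, ∫ y, f y ∂(Measure.dirac (x i)) = f (x i) := fun i =>
        integral_dirac' _ _ f.continuous.measurable.stronglyMeasurable
      simp only [hd, Function.comp_apply, smul_eq_mul, ENNReal.toReal_inv]
      rw [ENNReal.toReal_add (by finiteness) (by finiteness)]
      push_cast
      rw [ENNReal.toReal_natCast, ENNReal.toReal_one]
      ring
    · exact fun i _ => f.integrable _
  · exact h.2 f

end Reference

/-! ### Consistency of the nearest neighbour estimator -/

section Estimator

theorem sum_measureReal_preimage_mul {F : Type*} [MeasurableSpace F] (ν : Measure F)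
    [IsFiniteMeasure ν] {κ : F → ℕ} (hκ : Measurable κ) {n : ℕ} (hκn : ∀ y, κ y ≤ n)
    (c : ℕ → ℝ) :
    ∑ k ∈ Finset.range (n + 1), ν.real (κ ⁻¹' {k}) * c k = ∫ y, c (κ y) ∂ν := by
  have hm : ∀ k, MeasurableSet (κ ⁻¹' {k}) := fun k => hκ (measurableSet_singleton k)
  have h1 : ∀ y, c (κ y) = ∑ k ∈ Finset.range (n + 1), (κ ⁻¹' {k}).indicator (fun _ => c k) y := by
    intro y
    rw [Finset.sum_eq_single_of_mem (κ y) (Finset.mem_range.2 (Nat.lt_succ_of_le (hκn y)))]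
    · simp
    · intro k _ hk
      exact Set.indicator_of_notMem (fun h => hk h.symm) _
  simp_rw [h1]
  rw [integral_finsetSum _ fun k _ => (integrable_const (c k)).indicator (hm k)]
  exact Finset.sum_congr rfl fun k _ => by rw [integral_indicator_const _ (hm k), smul_eq_mul]

variable {E : Type*} [NormedAddCommGroup E] {F : Type*} [NormedAddCommGroup F]
  [MeasurableSpace F] [BorelSpace F]

/-- If the sampled pairs become dense around `{u n} × S`, the nearest neighbour approximation of
`∫ φ (u n, y) ν n (dy)` is consistent, provided that `ν n` puts asymptotically no mass away
from `S`. -/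
theorem tendsto_sum_sub_integral_reference [InnerProductSpace ℝ E] {φ : E × F → ℝ}
    (hφ : UniformContinuous φ) {M : ℝ}
    (hM : ∀ p, |φ p| ≤ M) {S : Set F} (hSne : S.Nonempty) {ν : ℕ → Measure F}
    [∀ n, IsProbabilityMeasure (ν n)] {u : ℕ → E} {x : ℕ → F}
    (hnear : ∀ ε > 0, ∀ᶠ n in atTop, ∀ y ∈ S, ∃ k ≤ n, ‖u n - u k‖ + ‖y - x k‖ < ε)
    {α : ℕ → ℕ → ℝ}
    (hα : ∀ n, ∃ κ : F → ℕ, Measurable κ ∧ (∀ y, IsNearestIndex u x n y (κ y)) ∧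
      ∀ k ≤ n, α n k = (ν n).real (κ ⁻¹' {k}))
    (hνS : ∀ m : ℕ, Tendsto (fun n => ∫ y, min 1 (m * Metric.infDist y S) ∂(ν n)) atTop (𝓝 0)) :
    Tendsto (fun n => ∑ k ∈ Finset.range (n + 1), α n k * φ (u k, x k)
      - ∫ y, φ (u n, y) ∂(ν n)) atTop (𝓝 0) := by
  have hM0 : 0 ≤ M := (abs_nonneg _).trans (hM (u 0, x 0))
  rw [Metric.tendsto_nhds]
  intro ε hε
  obtain ⟨δ, hδ, hunif⟩ := Metric.uniformContinuous_iff.1 hφ (ε / 2) (by positivity)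
  obtain ⟨m, hm⟩ := exists_nat_gt (4 / δ)
  have hsmall : ∀ᶠ n in atTop,
      2 * M * ∫ y, min 1 (m * Metric.infDist y S) ∂(ν n) < ε / 2 := by
    have := (hνS m).const_mul (2 * M)
    rw [mul_zero] at this
    exact this.eventually (gt_mem_nhds (by positivity))
  filter_upwards [hsmall, hnear (δ / 2) (by positivity)] with n hn hne
  obtain ⟨κ, hκm, hκ, hακ⟩ := hα n
  have hf0 : ∀ y, 0 ≤ min 1 (m * Metric.infDist y S) := fun y =>
    le_min zero_le_one (mul_nonneg (Nat.cast_nonneg _) Metric.infDist_nonneg)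
  have hfi : Integrable (fun y => min 1 (m * Metric.infDist y S)) (ν n) := by
    refine Integrable.of_bound (C := 1) ?_ (Eventually.of_forall fun y => ?_)
    · exact (continuous_const.min
        (continuous_const.mul (Metric.continuous_infDist_pt S))).aestronglyMeasurable
    · rw [Real.norm_of_nonneg (hf0 y)]
      exact min_le_left _ _
  have h1i : Integrable (fun y => φ (u (κ y), x (κ y))) (ν n) :=
    Integrable.of_bound (C := M)
      ((measurable_from_nat (f := fun k => φ (u k, x k))).comp hκm).aestronglyMeasurable
      (Eventually.of_forall fun y => hM _)
  have h2i : Integrable (fun y => φ (u n, y)) (ν n) :=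
    Integrable.of_bound (C := M)
      (hφ.continuous.comp (by fun_prop : Continuous fun y : F => (u n, y))).aestronglyMeasurable
      (Eventually.of_forall fun y => hM _)
  have hsum : ∑ k ∈ Finset.range (n + 1), α n k * φ (u k, x k)
      = ∫ y, φ (u (κ y), x (κ y)) ∂(ν n) := by
    rw [← sum_measureReal_preimage_mul (ν n) hκm (fun y => (hκ y).1) fun k => φ (u k, x k)]
    refine Finset.sum_congr rfl fun k hk => ?_
    rw [hακ k (Nat.lt_succ_iff.1 (Finset.mem_range.1 hk))]
  have hpt : ∀ y, |φ (u (κ y), x (κ y)) - φ (u n, y)|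
      ≤ ε / 2 + 2 * M * min 1 (m * Metric.infDist y S) := by
    intro y
    by_cases hy : Metric.infDist y S < δ / 4
    · -- the nearest neighbour of `y` is almost as near as that of a point of `S` close to `y`
      obtain ⟨y', hy', hd⟩ := (Metric.infDist_lt_iff hSne).1 hy
      obtain ⟨k, hkn, hk⟩ := hne y' hy'
      have h3 := (hκ y).2 k hkn
      have h4 : ‖y - x k‖ ≤ ‖y - y'‖ + ‖y' - x k‖ := norm_sub_le_norm_sub_add_norm_sub _ _ _
      rw [dist_eq_norm] at hd
      have h5 : dist (u (κ y), x (κ y)) (u n, y) < δ := by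
        rw [Prod.dist_eq, max_lt_iff, dist_comm, dist_comm (x (κ y)), dist_eq_norm, dist_eq_norm]
        constructor <;> dsimp only <;> linarith [norm_nonneg (u n - u (κ y)),
          norm_nonneg (y - x (κ y))]
      have h6 := hunif h5
      rw [Real.dist_eq] at h6
      nlinarith [hf0 y]
    · -- away from `S` the test function equals `1` and the trivial bound suffices
      have h3 : min 1 (m * Metric.infDist y S) = 1 := by
        refine min_eq_left ?_
        rw [div_lt_iff₀ hδ] at hm
        push Not at hy
        nlinarith
      rw [h3]
      have := abs_sub (φ (u (κ y), x (κ y))) (φ (u n, y))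
      linarith [hM (u (κ y), x (κ y)), hM (u n, y)]
  rw [dist_zero_right, hsum, ← integral_sub h1i h2i]
  refine (norm_integral_le_of_norm_le ((integrable_const _).add (hfi.const_mul (2 * M)))
    (Eventually.of_forall hpt)).trans_lt ?_
  rw [integral_add' (integrable_const _) (hfi.const_mul (2 * M)), integral_const_mul]
  simp only [integral_const, probReal_univ, one_smul]
  linarith

/-- Convergence of `∫ φ (p, y) ν n (dy)` for `p` in a dense sequence is uniform on compact sets,
since `φ` is uniformly continuous. -/
theorem tendsto_integral_reference_sub_integral [TopologicalSpace.SeparableSpace E] {φ : E × F → ℝ}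
    (hφ : UniformContinuous φ) {M : ℝ} (hM : ∀ p, |φ p| ≤ M) {U : Set E} (hUc : IsCompact U)
    {μ : Measure F} [IsProbabilityMeasure μ] {ν : ℕ → Measure F}
    [∀ n, IsProbabilityMeasure (ν n)] {u : ℕ → E} (hu : ∀ n, u n ∈ U)
    (hν : ∀ i : ℕ, Tendsto (fun n => ∫ y, φ (TopologicalSpace.denseSeq E i, y) ∂(ν n)) atTop
      (𝓝 (∫ y, φ (TopologicalSpace.denseSeq E i, y) ∂μ))) :
    Tendsto (fun n => ∫ y, φ (u n, y) ∂(ν n) - ∫ y, φ (u n, y) ∂μ) atTop (𝓝 0) := by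
  rw [Metric.tendsto_nhds]
  intro ε hε
  obtain ⟨δ, hδ, hunif⟩ := Metric.uniformContinuous_iff.1 hφ (ε / 3) (by positivity)
  obtain ⟨I, hI⟩ := hUc.elim_finite_subcover _
    (fun i => Metric.isOpen_ball (x := TopologicalSpace.denseSeq E i) (ε := δ))
    (fun p _ => Set.mem_iUnion.2
      ((TopologicalSpace.denseRange_denseSeq E).exists_dist_lt p hδ))
  have hev := (eventually_all_finset I).2 fun i _ =>
    Metric.tendsto_nhds.1 (hν i) (ε / 3) (by positivity)
  have hint : ∀ (ρ : Measure F) [IsProbabilityMeasure ρ] (p : E),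
      Integrable (fun y => φ (p, y)) ρ := fun ρ _ p =>
    Integrable.of_bound (C := M)
      (hφ.continuous.comp (by fun_prop : Continuous fun y : F => (p, y))).aestronglyMeasurable
      (Eventually.of_forall fun y => hM _)
  filter_upwards [hev] with n hn
  obtain ⟨i, hi, hui⟩ := Set.mem_iUnion₂.1 (hI (hu n))
  have hclose : ∀ (ρ : Measure F) [IsProbabilityMeasure ρ],
      |∫ y, φ (u n, y) ∂ρ - ∫ y, φ (TopologicalSpace.denseSeq E i, y) ∂ρ| ≤ ε / 3 := by
    intro ρ _
    rw [← integral_sub (hint ρ _) (hint ρ _)]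
    have := norm_integral_le_of_norm_le_const (μ := ρ) (C := ε / 3)
      (f := fun y => φ (u n, y) - φ (TopologicalSpace.denseSeq E i, y))
      (Eventually.of_forall fun y => by
        rw [← dist_eq_norm]
        refine (hunif ?_).le
        simpa [Prod.dist_eq] using hui)
    simpa using this
  have h1 := abs_le.1 (hclose (ν n))
  have h2 := abs_le.1 (hclose μ)
  have h3 := hn i hi
  rw [Real.dist_eq, abs_lt] at h3
  rw [dist_zero_right, Real.norm_eq_abs, abs_lt]
  constructor <;> linarith [h1.1, h1.2, h2.1, h2.2, h3.1, h3.2]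

end Estimator

/-- A real function that is continuous on a compact subset of a proper space agrees there with a
bounded, uniformly continuous function on the whole space. -/
theorem exists_uniformContinuous_eqOn {Z : Type*} [PseudoMetricSpace Z] [ProperSpace Z] [T2Space Z]
    {K : Set Z} (hK : IsCompact K) {f : Z → ℝ} (hf : ContinuousOn f K) :
    ∃ φ : Z → ℝ, UniformContinuous φ ∧ (∃ M, ∀ z, |φ z| ≤ M) ∧ Set.EqOn φ f K := by
  rcases K.eq_empty_or_nonempty with rfl | hne
  · exact ⟨fun _ => 0, uniformContinuous_const, ⟨0, by simp⟩, fun _ h => h.elim⟩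
  obtain ⟨h, hh⟩ := ContinuousMap.exists_restrict_eq hK.isClosed
    (⟨K.domRestrict f, continuousOn_iff_continuous_domRestrict.1 hf⟩ : C(K, ℝ))
  -- multiply a continuous extension by a cutoff function
  set φ : Z → ℝ := fun z => max 0 (1 - Metric.infDist z K) * h z with hφ
  have hc : Continuous φ :=
    (continuous_const.max (continuous_const.sub (Metric.continuous_infDist_pt K))).mul h.continuous
  have hsupp : HasCompactSupport φ := by
    refine HasCompactSupport.intro (K := Metric.cthickening 1 K) hK.cthickening fun z hz => ?_
    have : 1 < Metric.infDist z K := by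
      by_contra! hle
      obtain ⟨w, hw, hzw⟩ := hK.exists_infDist_eq_dist hne z
      exact hz (Metric.mem_cthickening_of_dist_le z w 1 K hw (hzw ▸ hle))
    simp only [hφ]
    rw [max_eq_left (by linarith), zero_mul]
  obtain ⟨M, hM⟩ := hsupp.exists_bound_of_continuous hc
  refine ⟨φ, hsupp.uniformContinuous_of_continuous hc, ⟨M, hM⟩, fun z hz => ?_⟩
  have h1 : h z = f z := congrArg (fun k : C(K, ℝ) => k ⟨z, hz⟩) hh
  simp only [hφ, Metric.infDist_zero_of_mem hz, h1]
  norm_num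

section Consistency

/-- Almost sure consistency of the nearest neighbour estimator. Only countably many test functions
are needed to control the reference measures, so that for empirical weights the strong law of
large numbers suffices. -/
theorem ae_tendsto_sum_sub_integral {E : Type*} [NormedAddCommGroup E] [InnerProductSpace ℝ E]
    [TopologicalSpace.SeparableSpace E] {F : Type*} [NormedAddCommGroup F] [MeasurableSpace F]
    [BorelSpace F] {φ : E × F → ℝ} (hφ : UniformContinuous φ) {M : ℝ} (hM : ∀ p, |φ p| ≤ M)
    {U : Set E} (hUc : IsCompact U) {μ : Measure F} [IsProbabilityMeasure μ] {S : Set F}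
    (hSne : S.Nonempty) (hμS : ∀ᵐ y ∂μ, y ∈ S)
    {Ω : Type*} {mΩ : MeasurableSpace Ω} {P : Measure Ω} {ℱ : Filtration ℕ mΩ} {x : ℕ → Ω → F}
    (hx : ∀ n, Measurable[ℱ n] (x n)) (hlaw : ∀ n, P.map (x n) = μ)
    (hindep : ∀ n, Indep (MeasurableSpace.comap (x (n + 1)) inferInstance) (ℱ n) P)
    {α : ℕ → ℕ → Ω → ℝ} {u : ℕ → Ω → E} (hu : ∀ n ω, u n ω ∈ U)
    (hα : ∀ᵐ ω ∂P, IsCSGWeights μ (fun n => x n ω) (fun n => u n ω) (fun n k => α n k ω))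
    (hnear : ∀ᵐ ω ∂P, ∀ ε > 0, ∀ᶠ n in atTop, ∀ y ∈ S, ∃ k ≤ n,
      ‖u n ω - u k ω‖ + ‖y - x k ω‖ < ε) :
    ∀ᵐ ω ∂P, Tendsto (fun n => ∑ k ∈ Finset.range (n + 1), α n k ω * φ (u k ω, x k ω)
      - ∫ y, φ (u n ω, y) ∂μ) atTop (𝓝 0) := by
  let f : ℕ → F →ᵇ ℝ := fun m => BoundedContinuousFunction.ofNormedAddCommGroup
    (fun y => min 1 (m * Metric.infDist y S))
    (continuous_const.min (continuous_const.mul (Metric.continuous_infDist_pt S))) 1 fun y => by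
      rw [Real.norm_of_nonneg
        (le_min zero_le_one (mul_nonneg (Nat.cast_nonneg _) Metric.infDist_nonneg))]
      exact min_le_left _ _
  let h : ℕ → F →ᵇ ℝ := fun i => BoundedContinuousFunction.ofNormedAddCommGroup
    (fun y => φ (TopologicalSpace.denseSeq E i, y))
    (hφ.continuous.comp (by fun_prop)) M fun y => hM _
  have hf0 : ∀ m, ∫ y, f m y ∂μ = 0 := fun m => by
    refine integral_eq_zero_of_ae (hμS.mono fun y hy => ?_)
    simp [f, Metric.infDist_zero_of_mem hy]
  have havg : ∀ f : F →ᵇ ℝ, ∀ᵐ ω ∂P,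
      Tendsto (fun n : ℕ => (∑ i ∈ Finset.range n, f (x i ω)) / n) atTop (𝓝 (∫ y, f y ∂μ)) :=
    fun f => ae_tendsto_average hx hlaw hindep f.continuous.measurable (f.integrable μ)
  filter_upwards [hα, hnear, ae_all_iff.2 fun m => havg (f m), ae_all_iff.2 fun i => havg (h i)]
    with ω ⟨ν, hν, hκ⟩ hω hfω hhω
  have hprob := hν.isProbabilityMeasure
  have h1 := tendsto_sum_sub_integral_reference hφ hM hSne hω hκ fun m =>
    hf0 m ▸ hν.tendsto_integral (f m) (hfω m)
  have h2 := tendsto_integral_reference_sub_integral hφ hM hUc (fun n => hu n ω) fun i =>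
    hν.tendsto_integral (h i) (hhω i)
  simpa using h1.add h2

/-- Almost surely, the CSG search directions approximate the gradient `∫ g (u n, y) μ(dy)` of the
objective at the current iterate with vanishing error. -/
theorem ae_tendsto_searchDirection_sub_integral {E : Type*} [NormedAddCommGroup E]
    [InnerProductSpace ℝ E] [FiniteDimensional ℝ E] {F : Type*} [NormedAddCommGroup F]
    [ProperSpace F] [MeasurableSpace F] [BorelSpace F]
    {U : Set E} (hUc : IsCompact U) {μ : Measure F} [IsProbabilityMeasure μ]
    (hS : IsCompact μ.support) {g : E → F → E}
    (hgc : ContinuousOn (fun p : E × F => g p.1 p.2) (U ×ˢ μ.support))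
    {Ω : Type*} {mΩ : MeasurableSpace Ω} {P : Measure Ω} {ℱ : Filtration ℕ mΩ} {x : ℕ → Ω → F}
    (hx : ∀ n, Measurable[ℱ n] (x n)) (hlaw : ∀ n, P.map (x n) = μ)
    (hindep : ∀ n, Indep (MeasurableSpace.comap (x (n + 1)) inferInstance) (ℱ n) P)
    {α : ℕ → ℕ → Ω → ℝ} {u : ℕ → Ω → E} (hu : ∀ n ω, u n ω ∈ U)
    (hα : ∀ᵐ ω ∂P, IsCSGWeights μ (fun n => x n ω) (fun n => u n ω) (fun n k => α n k ω))
    (hnear : ∀ᵐ ω ∂P, ∀ ε > 0, ∀ᶠ n in atTop, ∀ y ∈ μ.support, ∃ k ≤ n,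
      ‖u n ω - u k ω‖ + ‖y - x k ω‖ < ε) :
    ∀ᵐ ω ∂P, Tendsto (fun n => searchDirection g (fun n => x n ω) (fun n => u n ω)
      (fun n k => α n k ω) n - ∫ y, g (u n ω) y ∂μ) atTop (𝓝 0) := by
  have hμS : ∀ᵐ y ∂μ, y ∈ μ.support := Measure.support_mem_ae
  have hSne : μ.support.Nonempty := Measure.nonempty_support (NeZero.ne μ)
  have hxS : ∀ᵐ ω ∂P, ∀ n, x n ω ∈ μ.support := ae_all_iff.2 fun n => by
    rw [← hlaw n] at hμS
    have := ae_of_ae_map ((hx n).mono (ℱ.le n) le_rfl).aemeasurable hμS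
    rwa [hlaw n] at this
  let b := stdOrthonormalBasis ℝ E
  have hext : ∀ i, ∃ φ : E × F → ℝ, UniformContinuous φ ∧ (∃ M, ∀ z, |φ z| ≤ M) ∧
      Set.EqOn φ (fun p => inner ℝ (b i) (g p.1 p.2)) (U ×ˢ μ.support) := fun i =>
    exists_uniformContinuous_eqOn (hUc.prod hS) (continuousOn_const.inner hgc)
  choose φ hφ hM hφg using hext
  have hest : ∀ᵐ ω ∂P, ∀ i, Tendsto (fun n => ∑ k ∈ Finset.range (n + 1),
      α n k ω * φ i (u k ω, x k ω) - ∫ y, φ i (u n ω, y) ∂μ) atTop (𝓝 0) :=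
    ae_all_iff.2 fun i => by
      obtain ⟨M, hM⟩ := hM i
      exact ae_tendsto_sum_sub_integral (hφ i) hM hUc hSne hμS hx hlaw hindep hu hα hnear
  filter_upwards [hest, hxS] with ω hω hxω
  have hgi : ∀ n, Integrable (g (u n ω)) μ := fun n =>
    integrable_of_continuousOn_of_ae_mem hS hμS
      (hgc.comp (by fun_prop : ContinuousOn (fun y : F => (u n ω, y)) μ.support)
        fun y hy => Set.mk_mem_prod (hu n ω) hy)
  have hcoord : ∀ i, Tendsto (fun n => inner ℝ (b i) (searchDirection g (fun n => x n ω)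
      (fun n => u n ω) (fun n k => α n k ω) n - ∫ y, g (u n ω) y ∂μ)) atTop (𝓝 0) := by
    intro i
    refine (hω i).congr fun n => ?_
    rw [inner_sub_right, ← integral_inner (hgi n), searchDirection, inner_sum]
    congr 1
    · refine Finset.sum_congr rfl fun k _ => ?_
      rw [real_inner_smul_right, hφg i ⟨hu k ω, hxω k⟩]
    · exact integral_congr_ae (hμS.mono fun y hy => hφg i ⟨hu n ω, hy⟩)
  have hsum := tendsto_finsetSum Finset.univ fun i _ => (hcoord i).smul_const (b i)
  simp only [b.sum_repr', zero_smul, Finset.sum_const_zero] at hsum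
  exact hsum

end Consistency

end CSG

/-! ### Almost sure convergence of the iterates -/

theorem mainTheorem1
    {E : Type*} [NormedAddCommGroup E] [InnerProductSpace ℝ E] [FiniteDimensional ℝ E]
    {F : Type*} [NormedAddCommGroup F] [NormedSpace ℝ F] [FiniteDimensional ℝ F]
    [MeasurableSpace F] [BorelSpace F]
    -- the admissible set, the parameter set and the probability measure on it
    (U : Set E) (hUcompact : IsCompact U) (hUconvex : Convex ℝ U)
    (X : Set F) (hXopen : IsOpen X) (hXbdd : Bornology.IsBounded X)
    (μ : Measure F) [IsProbabilityMeasure μ] (hμ : μ.support ⊆ X)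
    -- the integrand, of class `C¹` on `U × X`, and its partial gradient
    (j : E → F → ℝ) (hj : ContDiffOn ℝ 1 (fun p : E × F => j p.1 p.2) (U ×ˢ X))
    (g : E → F → E) (hg : ∀ y ∈ X, CSG.IsGradientOn (fun u => j u y) (fun u => g u y) U)
    (hgcont : ContinuousOn (fun p : E × F => g p.1 p.2) (U ×ˢ X))
    -- the objective is `L`-smooth on `U`
    (G : E → E) (hG : CSG.IsGradientOn (CSG.objective j X μ) G U)
    (L : ℝ) (hL : 0 < L) (hsmooth : ∀ u ∈ U, ∀ v ∈ U, ‖G u - G v‖ ≤ L * ‖u - v‖)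
    (hfin : (CSG.stationaryPoints U G).Finite)
    -- the samples: independent with law `μ`; `ℱ n` is the information available in step `n`
    {Ω : Type*} [mΩ : MeasurableSpace Ω] (P : Measure Ω) [IsProbabilityMeasure P]
    (ℱ : Filtration ℕ mΩ) (x : ℕ → Ω → F)
    (hxX : ∀ n ω, x n ω ∈ X)
    (hxadapted : ∀ n, Measurable[ℱ n] (x n))
    (hxlaw : ∀ n, P.map (x n) = μ)
    (hxindep : ∀ n, Indep (MeasurableSpace.comap (x (n + 1)) inferInstance) (ℱ n) P)
    -- the CSG method with constant step size
    (u₀ : E) (hu₀ : u₀ ∈ U) (τ : ℝ) (hτpos : 0 < τ) (hτ : τ < 2 / L)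
    (α : ℕ → ℕ → Ω → ℝ) (hαadapted : ∀ n k, Measurable[ℱ n] (α n k))
    (u : ℕ → Ω → E)
    (hα : ∀ᵐ ω ∂P, CSG.IsCSGWeights μ (fun n => x n ω) (fun n => u n ω) (fun n k => α n k ω))
    (hu : ∀ ω, CSG.IsCSGSequence U g u₀ (fun _ => τ) (fun n => x n ω) (fun n k => α n k ω)
      (fun n => u n ω)) :
    ∀ᵐ ω ∂P, ∃ uStar ∈ CSG.stationaryPoints U G,
      Tendsto (fun n => u n ω) atTop (𝓝 uStar) := by
  borelize E
  have : ProperSpace F := FiniteDimensional.proper ℝ F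
  have hμS : ∀ᵐ y ∂μ, y ∈ μ.support := Measure.support_mem_ae
  have hS : IsCompact μ.support :=
    Metric.isCompact_of_isClosed_isBounded Measure.isClosed_support (hXbdd.subset hμ)
  have hgc := hgcont.mono (Set.prod_mono_right hμ : U ×ˢ μ.support ⊆ U ×ˢ X)
  have huU : ∀ n ω, u n ω ∈ U := fun n ω => (hu ω).mem hu₀ n
  have hgrad := CSG.isGradientOn_objective hUcompact hUconvex hS hμ hμS
    (hj.continuousOn.mono (Set.prod_mono_right hμ)) (fun y hy => hg y (hμ hy)) hgc
  have hnear := CSG.ae_eventually_forall_exists_near hUcompact hS hxadapted hxlaw hxindep huU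
    (CSG.IsCSGSequence.measurable hUcompact hUconvex hgcont hxX hxadapted hu₀ hαadapted hu)
  filter_upwards [CSG.ae_tendsto_searchDirection_sub_integral hUcompact hS hgc hxadapted hxlaw
    hxindep huU hα hnear] with ω hω
  refine CSG.exists_tendsto_of_error_tendsto_zero hUcompact hUconvex hG hL hsmooth hfin hτpos hτ
    (fun n => huU n ω) (fun n => (hu ω).2 n) (fun n v hv w hw => ?_) hω
  rw [inner_add_left, inner_sub_left, hG.inner_sub_eq hUconvex hgrad (huU n ω) hv hw]
  ring
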